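/- Let $X$ be a compact Hausdorff, path-connected topological space admitting a universal cover, that is, a simply connected covering space which covers (compatibly with base points) every path-connected covering space of $X$. Let $\mathfrak a\in H^1(X;\mathbb R)$ be a singular cohomology class, represented by a singular one-cocycle $\alpha$, let $\operatorname{Homeo}(X,\mathfrak a)$ be the group of homeomorphisms $h$ of $X$ with $h^*\mathfrak a=\mathfrak a$, and let $G\subseteq \operatorname{Homeo}(X,\mathfrak a)$ be a subgroup. Suppose that $g\in G$ has two fixed points $x,y\in X$ and that $\gamma$ is a path in $X$ from $x$ to $y$ such that $$\int_\gamma (g^*\alpha-\alpha)\neq 0,$$ where $\int_\gamma\sigma$ denotes the value of the singular one-cochain $\sigma$ on the path $\gamma$, viewed as a singular one-simplex. Then $g$ is undistorted in $G$: for every finitely generated subgroup $\Gamma\le G$ containing $g$ and every finite generating set $S$ of $\Gamma$, the limit $\lim_{n\to\infty}|g^n|_S/n$ exists and is positive, where $|\cdot|_S$ is the word norm on $\Gamma$ with respect to $S$ (the least length of a word in elements of $S$ and their inverses). -/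

import Mathlib

open Filter Topology

universe u v w

noncomputable section

namespace HomeoDistortion

/-! ### Universal covers -/

/-- `p : E → X` is a universal cover: a covering map with simply connected total space which is
universal among pointed path-connected covers of `X`.  When `X` is locally path-connected, the
second property follows from the first by the lifting criterion. -/
structure IsUniversalCover {E X : Type u} [TopologicalSpace E] [TopologicalSpace X]
    (p : E → X) : Prop where
  isCoveringMap : IsCoveringMap p
  simplyConnected : SimplyConnectedSpace E
  universal : ∀ (Y : Type u) [TopologicalSpace Y] [PathConnectedSpace Y] (q : Y → X),
    IsCoveringMap q → ∀ (e : E) (y : Y), p e = q y →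
      ∃ f : C(E, Y), (∀ z, q (f z) = p z) ∧ f e = y

/-- The space `X` admits a universal cover. -/
def HasUniversalCover (X : Type u) [TopologicalSpace X] : Prop :=
  ∃ (E : Type u) (_ : TopologicalSpace E) (p : E → X), IsUniversalCover p

/-! ### Singular cohomology with real coefficients -/

/-- Singular `n`-simplices of `X`. -/
abbrev SingularSimplex (n : ℕ) (X : Type u) [TopologicalSpace X] : Type u :=
  C(stdSimplex ℝ (Fin (n + 1)), X)

/-- The real vector space of singular `n`-cochains of `X`, that is, of linear functionals on
singular `n`-chains, given by their values on singular simplices. -/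
abbrev SingularCochain (n : ℕ) (X : Type u) [TopologicalSpace X] : Type u :=
  SingularSimplex n X → ℝ

/-- The inclusion of the `i`-th face (opposite to the `i`-th vertex) of the standard simplex. -/
def faceMap (n : ℕ) (i : Fin (n + 2)) :
    C(stdSimplex ℝ (Fin (n + 1)), stdSimplex ℝ (Fin (n + 2))) :=
  ⟨stdSimplex.map i.succAbove, stdSimplex.continuous_map _⟩

/-- The singular coboundary `(δ c)(σ) = ∑ᵢ (-1)ⁱ c(σ ∘ dᵢ)`. -/
def coboundary (n : ℕ) (X : Type u) [TopologicalSpace X] :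
    SingularCochain n X →ₗ[ℝ] SingularCochain (n + 1) X where
  toFun c σ := ∑ i : Fin (n + 2), (-1 : ℝ) ^ (i : ℕ) * c (σ.comp (faceMap n i))
  map_add' c d := by
    funext σ
    simp [mul_add, Finset.sum_add_distrib]
  map_smul' r c := by
    funext σ
    simp only [Pi.smul_apply, smul_eq_mul, RingHom.id_apply, Finset.mul_sum]
    exact Finset.sum_congr rfl fun i _ => by ring

/-- The pullback of singular cochains along a continuous map. -/
def pullback (n : ℕ) {X : Type u} {Y : Type v} [TopologicalSpace X] [TopologicalSpace Y]
    (f : C(X, Y)) : SingularCochain n Y →ₗ[ℝ] SingularCochain n X where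
  toFun c σ := c (f.comp σ)
  map_add' _ _ := rfl
  map_smul' _ _ := rfl

theorem coboundary_pullback (n : ℕ) {X : Type u} {Y : Type v} [TopologicalSpace X]
    [TopologicalSpace Y] (f : C(X, Y)) (c : SingularCochain n Y) :
    coboundary n X (pullback n f c) = pullback (n + 1) f (coboundary n Y c) := rfl

/-- Singular one-cocycles `Z¹(X; ℝ)`. -/
abbrev Z1 (X : Type u) [TopologicalSpace X] : Submodule ℝ (SingularCochain 1 X) :=
  LinearMap.ker (coboundary 1 X)

/-- Singular one-coboundaries `B¹(X; ℝ)`. -/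
abbrev B1 (X : Type u) [TopologicalSpace X] : Submodule ℝ (SingularCochain 1 X) :=
  LinearMap.range (coboundary 0 X)

/-- The first singular cohomology `H¹(X; ℝ) = Z¹(X; ℝ) / B¹(X; ℝ)`. -/
abbrev H1 (X : Type u) [TopologicalSpace X] : Type u :=
  Z1 X ⧸ (B1 X).submoduleOf (Z1 X)

/-- The cohomology class of a one-cocycle. -/
def H1.mk {X : Type u} [TopologicalSpace X] (α : Z1 X) : H1 X :=
  ((B1 X).submoduleOf (Z1 X)).mkQ α

/-- The pullback of one-cocycles. -/
def Z1.map {X : Type u} {Y : Type v} [TopologicalSpace X] [TopologicalSpace Y] (f : C(X, Y)) :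
    Z1 Y →ₗ[ℝ] Z1 X :=
  (pullback 1 f).restrict fun c hc => by
    rw [LinearMap.mem_ker] at hc ⊢
    rw [coboundary_pullback, hc, map_zero]

/-- The map `f^* : H¹(Y; ℝ) → H¹(X; ℝ)` induced by a continuous map `f : X → Y`. -/
def H1.map {X : Type u} {Y : Type v} [TopologicalSpace X] [TopologicalSpace Y] (f : C(X, Y)) :
    H1 Y →ₗ[ℝ] H1 X :=
  Submodule.mapQ _ _ (Z1.map f) (by
    rintro c ⟨b, hb⟩
    exact ⟨pullback 0 f b, by
      rw [coboundary_pullback, hb]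
      rfl⟩)

theorem H1.map_id {X : Type u} [TopologicalSpace X] (a : H1 X) :
    H1.map (ContinuousMap.id X) a = a := by
  obtain ⟨α, rfl⟩ := Submodule.Quotient.mk_surjective _ a
  rfl

theorem H1.map_comp {X : Type u} {Y : Type v} {Z : Type w} [TopologicalSpace X]
    [TopologicalSpace Y] [TopologicalSpace Z] (f : C(Y, Z)) (g : C(X, Y)) (a : H1 Z) :
    H1.map (f.comp g) a = H1.map g (H1.map f a) := by
  obtain ⟨α, rfl⟩ := Submodule.Quotient.mk_surjective _ a
  rfl

/-- `Homeo(X, a)`: the group of homeomorphisms of `X` preserving the class `a ∈ H¹(X; ℝ)`. -/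
def homeoPreserving {X : Type u} [TopologicalSpace X] (a : H1 X) : Subgroup (X ≃ₜ X) where
  carrier := {g | H1.map (g : C(X, X)) a = a}
  one_mem' := H1.map_id a
  mul_mem' := by
    intro g h hg hh
    have key : H1.map ((g * h : X ≃ₜ X) : C(X, X)) a
        = H1.map (h : C(X, X)) (H1.map (g : C(X, X)) a) :=
      H1.map_comp (g : C(X, X)) (h : C(X, X)) a
    exact key.trans ((congrArg _ hg).trans hh)
  inv_mem' := by
    intro g hg
    have key : H1.map ((g⁻¹ : X ≃ₜ X) : C(X, X)) (H1.map (g : C(X, X)) a) = a := by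
      rw [← H1.map_comp]
      have : (g : C(X, X)).comp ((g⁻¹ : X ≃ₜ X) : C(X, X)) = ContinuousMap.id X := by
        ext x
        exact g.apply_symm_apply x
      rw [this, H1.map_id]
    exact (congrArg _ (Eq.symm hg)).trans key

/-- A path, seen as a singular one-simplex from its source to its target. -/
def pathSimplex {X : Type u} [TopologicalSpace X] {x y : X} (γ : Path x y) :
    SingularSimplex 1 X :=
  γ.toContinuousMap.comp (stdSimplexHomeomorphUnitInterval : C(stdSimplex ℝ (Fin 2), unitInterval))

/-- The pairing `∫_γ σ` of a path with a one-cochain. -/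
def pathIntegral {X : Type u} [TopologicalSpace X] {x y : X} (γ : Path x y)
    (σ : SingularCochain 1 X) : ℝ :=
  σ (pathSimplex γ)

/-! ### Distortion in groups -/

/-- The word norm with respect to `S`: the least length of a word in the elements of `S` and their
inverses that represents `g`. (It is only used when `S` generates the group.) -/
def wordNorm {Γ : Type*} [Group Γ] (S : Set Γ) (g : Γ) : ℕ :=
  sInf {k | ∃ l : List Γ, l.length = k ∧ (∀ s ∈ l, s ∈ S ∨ s⁻¹ ∈ S) ∧ l.prod = g}

/-- `g` has translation length `τ = lim |gⁿ| / n` with respect to `S`. -/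
def HasTranslationLength {Γ : Type*} [Group Γ] (S : Set Γ) (g : Γ) (τ : ℝ) : Prop :=
  Tendsto (fun n : ℕ => (wordNorm S (g ^ n) : ℝ) / n) atTop (𝓝 τ)

/-- For a finitely generated group `Γ`: the element `g` has positive translation length with
respect to every finite generating set. -/
def IsUndistortedFG {Γ : Type*} [Group Γ] (g : Γ) : Prop :=
  ∀ S : Set Γ, S.Finite → Subgroup.closure S = ⊤ → ∃ τ : ℝ, 0 < τ ∧ HasTranslationLength S g τ

/-- For a general group `G`: the element `g` is undistorted in every finitely generated subgroup
of `G` that contains it. -/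
def IsUndistorted {G : Type*} [Group G] (g : G) : Prop :=
  ∀ Γ : Subgroup G, Γ.FG → ∀ hg : g ∈ Γ, IsUndistortedFG (⟨g, hg⟩ : Γ)

end HomeoDistortion

end

noncomputable section
namespace HomeoDistortion

open scoped unitInterval

/-! ### One-cocycles and paths -/

/-! On the universal cover `p : E → X` the cocycle `p^*α` has a potential `F`. Take a compact `D ⊆
E` that maps onto `X`, any section `s` of `p` with values in `D`, and `f = -F ∘ s`. If `h` preserves
the class and `k` lifts it to `E`, then `h^*(α + δf) - (α + δf)` has the potential `F (k (s x)) - F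
(s (h x))`. This compares `F` at two points of one fibre, lying in fixed compact sets, so it is
bounded (`exists_forall_bound_deviation`).

Deviations add up along products (`deviation_mul`), so a word changes the integral of `α + δf` along
any path by at most a constant times its length. For `g ^ n` and `γ` this change is exactly `n`
times the given nonzero number (`deviation_pow_of_fixed`). Hence the norm of `g ^ n` grows linearly,
and Fekete's lemma gives the limit. -/

/-- A map from the unit interval, seen as a singular one-simplex. -/
def intervalSimplex {X : Type u} [TopologicalSpace X] (f : C(I, X)) : SingularSimplex 1 X :=
  f.comp (stdSimplexHomeomorphUnitInterval : C(stdSimplex ℝ (Fin 2), I))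

/-- The affine map from the two-simplex to the square with image the triangle `{u ≤ v}`. -/
def triangleMap : C(stdSimplex ℝ (Fin 3), I × I) where
  toFun t := (⟨t 2, t.2.1 2, stdSimplex.le_one t 2⟩,
    ⟨t 1 + t 2, add_nonneg (t.2.1 1) (t.2.1 2), by
      have h := stdSimplex.sum_eq_one t
      have h0 := t.2.1 0
      rw [Fin.sum_univ_three] at h
      change 0 ≤ t 0 at h0
      linarith⟩)
  continuous_toFun := by
    have h (i : Fin 3) : Continuous fun t : stdSimplex ℝ (Fin 3) => t i :=
      (continuous_apply i).comp continuous_subtype_val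
    exact (Continuous.subtype_mk (h 2) _).prodMk (Continuous.subtype_mk ((h 1).add (h 2)) _)

theorem faceMap_apply_succAbove (n : ℕ) (i : Fin (n + 2)) (t : stdSimplex ℝ (Fin (n + 1)))
    (j : Fin (n + 1)) : faceMap n i t (i.succAbove j) = t j := by
  change (stdSimplex.map i.succAbove t) (i.succAbove j) = t j
  rw [stdSimplex.map_coe]
  simp [FunOnFinite.linearMap_apply_apply, Finset.filter_eq']

theorem faceMap_apply_self (n : ℕ) (i : Fin (n + 2)) (t : stdSimplex ℝ (Fin (n + 1))) :
    faceMap n i t i = 0 := by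
  change (stdSimplex.map i.succAbove t) i = 0
  rw [stdSimplex.map_coe]
  simp [FunOnFinite.linearMap_apply_apply, Fin.succAbove_ne]

theorem stdSimplex_two_add_eq_one (t : stdSimplex ℝ (Fin 2)) : t 0 + t 1 = 1 := by
  rw [← stdSimplex.sum_eq_one t, Fin.sum_univ_two]

theorem coboundary_one_apply {X : Type u} [TopologicalSpace X] (c : SingularCochain 1 X)
    (τ : SingularSimplex 2 X) :
    coboundary 1 X c τ =
      c (τ.comp (faceMap 1 0)) - c (τ.comp (faceMap 1 1)) + c (τ.comp (faceMap 1 2)) := by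
  change ∑ i : Fin 3, (-1 : ℝ) ^ (i : ℕ) * c (τ.comp (faceMap 1 i)) = _
  rw [Fin.sum_univ_three]
  simp
  ring

/-- The value of a cocycle on the boundary of the triangle `{u ≤ v}` vanishes. -/
theorem cocycle_triangle {X : Type u} [TopologicalSpace X] (β : Z1 X) (Φ : C(I × I, X))
    (a b d : C(I, X)) (ha : ∀ s, a s = Φ (s, 1)) (hb : ∀ s, b s = Φ (0, s))
    (hd : ∀ s, d s = Φ (s, s)) :
    (β : SingularCochain 1 X) (intervalSimplex d) =
      (β : SingularCochain 1 X) (intervalSimplex b) +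
        (β : SingularCochain 1 X) (intervalSimplex a) := by
  have h := congrFun (LinearMap.mem_ker.1 β.2) (Φ.comp triangleMap)
  rw [coboundary_one_apply] at h
  -- The faces opposite vertices 0, 1, 2 are the side `v = 1`, the diagonal and the side `u = 0`.
  have e0 : (Φ.comp triangleMap).comp (faceMap 1 0) = intervalSimplex a := by
    ext t
    have h1 := faceMap_apply_succAbove 1 0 t 0
    have h2 := faceMap_apply_succAbove 1 0 t 1
    have h3 := stdSimplex_two_add_eq_one t
    refine Eq.trans (congrArg Φ ?_) (ha _).symm
    exact Prod.ext (Subtype.ext h2) (Subtype.ext ((congrArg₂ (· + ·) h1 h2).trans h3))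
  have e1 : (Φ.comp triangleMap).comp (faceMap 1 1) = intervalSimplex d := by
    ext t
    have h1 := faceMap_apply_self 1 1 t
    have h2 := faceMap_apply_succAbove 1 1 t 1
    refine Eq.trans (congrArg Φ ?_) (hd _).symm
    exact Prod.ext (Subtype.ext h2)
      (Subtype.ext ((congrArg₂ (· + ·) h1 h2).trans (zero_add _)))
  have e2 : (Φ.comp triangleMap).comp (faceMap 1 2) = intervalSimplex b := by
    ext t
    have h1 := faceMap_apply_succAbove 1 2 t 1
    have h2 := faceMap_apply_self 1 2 t
    refine Eq.trans (congrArg Φ ?_) (hb _).symm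
    exact Prod.ext (Subtype.ext h2)
      (Subtype.ext ((congrArg₂ (· + ·) h1 h2).trans (add_zero _)))
  rw [e0, e1, e2] at h
  change _ = (0 : ℝ) at h
  linarith

theorem cocycle_const {X : Type u} [TopologicalSpace X] (β : Z1 X) (x : X) :
    (β : SingularCochain 1 X) (intervalSimplex (ContinuousMap.const I x)) = 0 := by
  have := cocycle_triangle β (ContinuousMap.const _ x) (.const I x) (.const I x) (.const I x)
    (fun _ => rfl) (fun _ => rfl) (fun _ => rfl)
  linarith

theorem pathIntegral_trans {X : Type u} [TopologicalSpace X] (β : Z1 X) {x y z : X}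
    (γ : Path x y) (γ' : Path y z) :
    pathIntegral (γ.trans γ') β = pathIntegral γ β + pathIntegral γ' β := by
  -- Under `(u, v) ↦ (u + v) / 2` the side `u = 0` runs through the first half, the side `v = 1`
  -- through the second, and the diagonal through everything.
  refine cocycle_triangle β ((γ.trans γ').toContinuousMap.comp
    ⟨fun p : I × I => (⟨(p.1 + p.2) / 2, by have := p.1.2.1; have := p.2.2.1; positivity, by
      have := p.1.2.2; have := p.2.2.2; linarith⟩ : I), by fun_prop⟩) _ _ _ ?_ ?_ ?_
  · intro s
    change γ' s = (γ.trans γ') _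
    rw [Path.trans_apply]
    split_ifs with h
    · have hs : s = 0 := by
        ext
        have h0 := s.2.1
        have h1 : ((s : ℝ) + 1) / 2 ≤ 1 / 2 := h
        have h2 : (s : ℝ) = 0 := by linarith
        exact h2
      subst hs
      simp
    · congr 1
      ext
      simp
      ring
  · intro s
    change γ s = (γ.trans γ') _
    rw [Path.trans_apply]
    split_ifs with h
    · congr 1
      ext
      simp
      ring
    · refine absurd ?_ h
      have := s.2.2
      simp
      linarith
  · intro s
    change (γ.trans γ') s = (γ.trans γ') _
    congr 1
    ext
    simp

/-- The diagonal cuts the square of the homotopy into two triangles, each with one constant side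
because the endpoints stay fixed. -/
theorem pathIntegral_congr_of_homotopic {X : Type u} [TopologicalSpace X] (β : Z1 X) {x y : X}
    {γ γ' : Path x y} (h : γ.Homotopic γ') :
    pathIntegral γ (β : SingularCochain 1 X) = pathIntegral γ' (β : SingularCochain 1 X) := by
  obtain ⟨H⟩ := h
  let d : C(I, X) := ⟨fun s => H (s, s), by fun_prop⟩
  have h1 := cocycle_triangle β H.toContinuousMap (.const I y) γ.toContinuousMap d
    (fun s => (H.target s).symm) (fun s => (H.apply_zero s).symm) (fun _ => rfl)
  have h2 := cocycle_triangle β (H.toContinuousMap.comp ⟨Prod.swap, continuous_swap⟩)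
    γ'.toContinuousMap (.const I x) d
    (fun s => (H.apply_one s).symm) (fun s => (H.source s).symm) (fun _ => rfl)
  rw [cocycle_const] at h1 h2
  change (β : SingularCochain 1 X) (intervalSimplex γ.toContinuousMap) =
    (β : SingularCochain 1 X) (intervalSimplex γ'.toContinuousMap)
  linarith

/-! ### Potentials of one-cochains -/

/-- A function whose differences along paths compute the one-cochain `c`. -/
def IsPotential {X : Type u} [TopologicalSpace X] (K : X → ℝ) (c : SingularCochain 1 X) : Prop :=
  ∀ ⦃x y : X⦄ (γ : Path x y), pathIntegral γ c = K y - K x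

theorem IsPotential.sub_eq_sub {X : Type u} [TopologicalSpace X] [PathConnectedSpace X]
    {c : SingularCochain 1 X} {K L : X → ℝ} (hK : IsPotential K c) (hL : IsPotential L c)
    (x y : X) : K x - L x = K y - L y := by
  have h1 := hK (PathConnectedSpace.somePath x y)
  have h2 := hL (PathConnectedSpace.somePath x y)
  linarith

theorem IsPotential.sub {X : Type u} [TopologicalSpace X] {c d : SingularCochain 1 X}
    {K L : X → ℝ} (hK : IsPotential K c) (hL : IsPotential L d) :
    IsPotential (fun x => K x - L x) (c - d) := by
  intro x y γ
  have h1 := hK γ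
  have h2 := hL γ
  change pathIntegral γ c - pathIntegral γ d = _
  linarith

theorem IsPotential.pullback {X : Type u} {Y : Type v} [TopologicalSpace X] [TopologicalSpace Y]
    {K : Y → ℝ} {c : SingularCochain 1 Y} (hK : IsPotential K c) (f : C(X, Y)) :
    IsPotential (K ∘ f) (pullback 1 f c) :=
  fun _ _ γ => hK (γ.map f.continuous)

theorem exists_isPotential_of_simplyConnected {E : Type u} [TopologicalSpace E]
    [SimplyConnectedSpace E] (β : Z1 E) : ∃ F : E → ℝ, IsPotential F β := by
  obtain ⟨e₀⟩ : Nonempty E := inferInstance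
  refine ⟨fun e => pathIntegral (PathConnectedSpace.somePath e₀ e) β, fun x y γ => ?_⟩
  dsimp only
  rw [pathIntegral_congr_of_homotopic β (SimplyConnectedSpace.paths_homotopic
    (PathConnectedSpace.somePath e₀ y) ((PathConnectedSpace.somePath e₀ x).trans γ)),
    pathIntegral_trans]
  ring

theorem exists_isPotential_of_mem_B1 {X : Type u} [TopologicalSpace X]
    {c : SingularCochain 1 X} (hc : c ∈ B1 X) : ∃ K : X → ℝ, IsPotential K c := by
  obtain ⟨b, rfl⟩ := hc
  refine ⟨fun x => b (ContinuousMap.const _ x), fun x y γ => ?_⟩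
  change ∑ i : Fin 2, (-1 : ℝ) ^ (i : ℕ) * b ((pathSimplex γ).comp (faceMap 0 i)) = _
  rw [Fin.sum_univ_two]
  have e0 : (pathSimplex γ).comp (faceMap 0 0) = ContinuousMap.const _ y := by
    ext t
    have h := (faceMap_apply_succAbove 0 0 t 0).trans ((Fin.sum_univ_one _).symm.trans (stdSimplex.sum_eq_one t))
    refine Eq.trans (congrArg γ ?_) γ.target
    exact Subtype.ext h
  have e1 : (pathSimplex γ).comp (faceMap 0 1) = ContinuousMap.const _ x := by
    ext t
    refine Eq.trans (congrArg γ ?_) γ.source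
    exact Subtype.ext (faceMap_apply_self 0 1 t)
  rw [e0, e1]
  simp
  ring

theorem exists_isPotential_of_mem_homeoPreserving {X : Type u} [TopologicalSpace X] (α : Z1 X)
    {h : X ≃ₜ X} (hh : h ∈ homeoPreserving (H1.mk α)) :
    ∃ K : X → ℝ, IsPotential K (pullback 1 (h : C(X, X)) (α : SingularCochain 1 X) - α) := by
  have h1 : (Submodule.Quotient.mk (Z1.map (h : C(X, X)) α) : H1 X) = Submodule.Quotient.mk α := hh
  rw [Submodule.Quotient.eq] at h1
  exact exists_isPotential_of_mem_B1 h1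

/-! ### Universal covers -/

/-- The image is also closed: over an evenly covered neighbourhood of `x`, a point above any `y`
slides along its sheet to a point above `x`. -/
theorem _root_.IsCoveringMap.surjective {E X : Type*} [TopologicalSpace E] [TopologicalSpace X]
    [Nonempty E] [PreconnectedSpace X] {p : E → X} (hp : IsCoveringMap p) :
    Function.Surjective p := by
  rw [← Set.range_eq_univ]
  refine IsClopen.eq_univ ⟨⟨isOpen_iff_mem_nhds.2 fun x hx => ?_⟩, hp.isOpenMap.isOpen_range⟩
    (Set.range_nonempty p)
  obtain ⟨-, U, hxU, hU, -, H, hH⟩ := hp x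
  filter_upwards [hU.mem_nhds hxU]
  rintro _ hyU ⟨e, rfl⟩
  exact hx ⟨(H.symm (⟨x, hxU⟩, (H ⟨e, hyU⟩).2)).1, by
    have := hH (H.symm (⟨x, hxU⟩, (H ⟨e, hyU⟩).2))
    simpa using this.symm⟩

/-- Finitely many compact neighbourhoods, lifted by local inverses, suffice. Their union replaces a
fundamental domain. -/
theorem _root_.IsLocalHomeomorph.exists_isCompact_image_eq_univ {E X : Type*} [TopologicalSpace E]
    [TopologicalSpace X] [CompactSpace X] [LocallyCompactSpace X] {p : E → X}
    (hp : IsLocalHomeomorph p) (hs : Function.Surjective p) :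
    ∃ D : Set E, IsCompact D ∧ p '' D = Set.univ := by
  have key (x : X) : ∃ D : Set E, IsCompact D ∧ p '' D ∈ 𝓝 x := by
    obtain ⟨e, rfl⟩ := hs x
    obtain ⟨φ, he, rfl⟩ := hp e
    obtain ⟨C, hC, hCs, hCc⟩ := local_compact_nhds (φ.open_target.mem_nhds (φ.map_source he))
    refine ⟨φ.symm '' C, hCc.image_of_continuousOn (φ.continuousOn_symm.mono hCs), ?_⟩
    rw [← Set.image_comp]
    convert hC
    exact (Set.EqOn.image_eq fun z hz => φ.right_inv (hCs hz)).trans (Set.image_id C)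
  choose D hD hDx using key
  obtain ⟨t, -, ht⟩ := isCompact_univ.elim_nhds_subcover (fun x => p '' D x) fun x _ => hDx x
  refine ⟨⋃ x ∈ t, D x, t.isCompact_biUnion fun x _ => hD x, ?_⟩
  rw [Set.image_iUnion₂]
  exact Set.univ_subset_iff.1 ht

namespace IsUniversalCover

variable {E X : Type u} [TopologicalSpace E] [TopologicalSpace X] {p : E → X}

/-- A homeomorphism of the base lifts to the universal cover. -/
theorem exists_lift [PathConnectedSpace X] (hp : IsUniversalCover p) (h : X ≃ₜ X) :
    ∃ k : C(E, E), ∀ z, p (k z) = h (p z) := by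
  have := hp.simplyConnected
  obtain ⟨e⟩ : Nonempty E := inferInstance
  obtain ⟨e', he'⟩ := hp.isCoveringMap.surjective (h (p e))
  -- A map from `p` to the cover `h.symm ∘ p` is a lift of `h`.
  obtain ⟨k, hk, -⟩ := hp.universal E (h.symm ∘ p) (hp.isCoveringMap.homeomorph_comp h.symm) e e'
    (by simp [he'])
  exact ⟨k, fun z => by simp [← hk z]⟩

/-- A potential on the universal cover of a one-cochain of the base has locally constant
differences along the fibres. -/
theorem isLocallyConstant_sub (hp : IsUniversalCover p) {F : E → ℝ} {c : SingularCochain 1 X}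
    (hF : IsPotential F (pullback 1 ⟨p, hp.isCoveringMap.continuous⟩ c)) :
    IsLocallyConstant fun q : {q : E × E // p q.1 = p q.2} => F q.1.2 - F q.1.1 := by
  have := hp.simplyConnected
  rw [IsLocallyConstant.iff_eventually_eq]
  rintro ⟨⟨a, b⟩, hab⟩
  -- Universality applied to `p` itself gives a deck map `T` with `T a = b`. `F ∘ T - F` is
  -- constant, and pairs near `(a, b)` have the form `(a', T a')`.
  obtain ⟨T, hT, hTa⟩ := hp.universal E p hp.isCoveringMap a b hab
  obtain ⟨U, hU, hbU, hinj⟩ := hp.isCoveringMap.isLocalHomeomorph.isLocallyInjective b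
  have hF' : IsPotential (F ∘ T) (pullback 1 ⟨p, hp.isCoveringMap.continuous⟩ c) := by
    have h1 := hF.pullback T
    have h2 : (⟨p, hp.isCoveringMap.continuous⟩ : C(E, X)).comp T =
        ⟨p, hp.isCoveringMap.continuous⟩ := ContinuousMap.ext hT
    have h3 : pullback 1 T (pullback 1 ⟨p, hp.isCoveringMap.continuous⟩ c) =
        pullback 1 ((⟨p, hp.isCoveringMap.continuous⟩ : C(E, X)).comp T) c := rfl
    rwa [h3, h2] at h1
  have hTU : ∀ᶠ q : {q : E × E // p q.1 = p q.2} in 𝓝 ⟨(a, b), hab⟩, T q.1.1 ∈ U :=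
    (by fun_prop : Continuous fun q : {q : E × E // p q.1 = p q.2} => T q.1.1).continuousAt
      |>.eventually_mem (hU.mem_nhds (by simpa [hTa] using hbU))
  have hbU' : ∀ᶠ q : {q : E × E // p q.1 = p q.2} in 𝓝 ⟨(a, b), hab⟩, q.1.2 ∈ U :=
    (by fun_prop : Continuous fun q : {q : E × E // p q.1 = p q.2} => q.1.2).continuousAt
      |>.eventually_mem (hU.mem_nhds hbU)
  filter_upwards [hTU, hbU'] with q h1 h2
  have h3 : T q.1.1 = q.1.2 := hinj h1 h2 ((hT _).trans q.2)
  have h4 := hF'.sub_eq_sub hF q.1.1 a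
  simp only [Function.comp_apply, h3, hTa] at h4
  exact h4

/-- `F` itself need not be continuous or bounded on compact sets. Only its differences on the fibre
product, which is closed as `X` is Hausdorff, are controlled. -/
theorem exists_bound_sub [T2Space X] (hp : IsUniversalCover p) {F : E → ℝ}
    {c : SingularCochain 1 X} (hF : IsPotential F (pullback 1 ⟨p, hp.isCoveringMap.continuous⟩ c))
    {D D' : Set E} (hD : IsCompact D) (hD' : IsCompact D') :
    ∃ C : ℝ, ∀ a ∈ D, ∀ b ∈ D', p a = p b → |F b - F a| ≤ C := by
  have hcl : IsClosed {q : E × E | p q.1 = p q.2} :=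
    isClosed_eq (hp.isCoveringMap.continuous.comp continuous_fst)
      (hp.isCoveringMap.continuous.comp continuous_snd)
  have hP : IsCompact ((Subtype.val : {q : E × E // p q.1 = p q.2} → E × E) ⁻¹' (D ×ˢ D')) :=
    hcl.isClosedEmbedding_subtypeVal.isCompact_preimage (hD.prod hD')
  obtain ⟨C, hC⟩ := hP.exists_bound_of_continuousOn
    (hp.isLocallyConstant_sub hF).continuous.continuousOn
  exact ⟨C, fun a ha b hb hab => hC ⟨(a, b), hab⟩ ⟨ha, hb⟩⟩

end IsUniversalCover

/-! ### Deviation of a corrected cocycle -/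

/-- The change of the integral along `γ` of the cocycle `α + δf` under `h`. -/
def deviation {X : Type u} [TopologicalSpace X] (c : SingularCochain 1 X) (f : X → ℝ)
    (h : X ≃ₜ X) {x y : X} (γ : Path x y) : ℝ :=
  pathIntegral γ (pullback 1 (h : C(X, X)) c - c) + ((f (h y) - f y) - (f (h x) - f x))

/-- Every class of degree one has a representative that is changed by every homeomorphism
preserving the class only by the coboundary of a bounded function. -/
theorem exists_forall_bound_deviation {X : Type u} [TopologicalSpace X] [CompactSpace X] [T2Space X]
    [PathConnectedSpace X] (hX : HasUniversalCover X) (α : Z1 X) :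
    ∃ f : X → ℝ, ∀ h ∈ homeoPreserving (H1.mk α), ∃ C : ℝ, ∀ ⦃x y : X⦄ (γ : Path x y),
      |deviation (α : SingularCochain 1 X) f h γ| ≤ C := by
  obtain ⟨E, _, p, hp⟩ := hX
  have := hp.simplyConnected
  have hpc := hp.isCoveringMap.continuous
  obtain ⟨F, hF⟩ := exists_isPotential_of_simplyConnected (Z1.map ⟨p, hpc⟩ α)
  obtain ⟨D, hD, hDp⟩ := hp.isCoveringMap.isLocalHomeomorph.exists_isCompact_image_eq_univ
    hp.isCoveringMap.surjective
  have hs (x : X) : ∃ e ∈ D, p e = x := by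
    have : x ∈ p '' D := hDp ▸ Set.mem_univ x
    exact this
  choose s hsD hs using hs
  refine ⟨fun x => -F (s x), fun h hh => ?_⟩
  obtain ⟨k, hk⟩ := hp.exists_lift h
  obtain ⟨C, hC⟩ := hp.exists_bound_sub (c := α) hF hD (hD.image k.continuous)
  obtain ⟨K, hK⟩ := exists_isPotential_of_mem_homeoPreserving α hh
  have hFk : IsPotential (fun e => F (k e) - F e)
      (pullback 1 ⟨p, hpc⟩ (pullback 1 (h : C(X, X)) (α : SingularCochain 1 X) - α)) := by
    have h1 := (hF.pullback k).sub hF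
    have h2 : (⟨p, hpc⟩ : C(E, X)).comp k = (h : C(X, X)).comp ⟨p, hpc⟩ := ContinuousMap.ext hk
    have h3 : pullback 1 k (Z1.map ⟨p, hpc⟩ α : SingularCochain 1 E) =
        pullback 1 ((⟨p, hpc⟩ : C(E, X)).comp k) (α : SingularCochain 1 X) := rfl
    rw [h3, h2] at h1
    exact h1
  have hKp := hK.pullback ⟨p, hpc⟩
  refine ⟨C + C, fun x y γ => ?_⟩
  -- Both are potentials of one cochain on `E`, so they differ by a constant, which cancels between
  -- `x` and `y`.
  have h1 := hKp.sub_eq_sub hFk (s x) (s y)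
  simp only [Function.comp_apply, ContinuousMap.coe_mk, hs] at h1
  have h2 (z : X) := hC (s (h z)) (hsD _) (k (s z)) ⟨s z, hsD z, rfl⟩ (by rw [hk, hs, hs])
  have h3 : deviation (α : SingularCochain 1 X) (fun x => -F (s x)) h γ =
      (F (k (s y)) - F (s (h y))) - (F (k (s x)) - F (s (h x))) := by
    rw [deviation, hK γ]
    linarith
  rw [h3]
  exact (abs_sub _ _).trans (add_le_add (h2 y) (h2 x))

/-- The path changes to its image under `k`, which is why the bounds must be uniform over all paths.
-/
theorem deviation_mul {X : Type u} [TopologicalSpace X] (c : SingularCochain 1 X) (f : X → ℝ)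
    (h k : X ≃ₜ X) {x y : X} (γ : Path x y) :
    deviation c f (h * k) γ = deviation c f h (γ.map k.continuous) + deviation c f k γ := by
  change (c _ - c _) + ((f (h (k y)) - f y) - (f (h (k x)) - f x)) =
    ((c (pathSimplex ((γ.map k.continuous).map h.continuous)) -
        c (pathSimplex (γ.map k.continuous)))
      + ((f (h (k y)) - f (k y)) - (f (h (k x)) - f (k x))))
      + ((c (pathSimplex (γ.map k.continuous)) - c (pathSimplex γ))
        + ((f (k y) - f y) - (f (k x) - f x)))
  have e : ((h * k : X ≃ₜ X) : C(X, X)).comp (pathSimplex γ) =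
      pathSimplex ((γ.map k.continuous).map h.continuous) := rfl
  rw [e]
  ring

theorem deviation_one {X : Type u} [TopologicalSpace X] (c : SingularCochain 1 X) (f : X → ℝ)
    {x y : X} (γ : Path x y) : deviation c f 1 γ = 0 := by
  change (c (pathSimplex γ) - c (pathSimplex γ)) + ((f y - f y) - (f x - f x)) = 0
  ring

theorem abs_deviation_list_prod_le {X : Type u} [TopologicalSpace X] (c : SingularCochain 1 X)
    (f : X → ℝ) {C : ℝ} (l : List (X ≃ₜ X))
    (hl : ∀ h ∈ l, ∀ ⦃x y : X⦄ (γ : Path x y), |deviation c f h γ| ≤ C) {x y : X} (γ : Path x y) :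
    |deviation c f l.prod γ| ≤ l.length * C := by
  induction l generalizing x y with
  | nil => simp [deviation_one]
  | cons h l ih =>
    rw [List.prod_cons, deviation_mul]
    have h1 := hl h (by simp) (γ.map l.prod.continuous)
    have h2 := ih (fun k hk => hl k (by simp [hk])) γ
    refine (abs_add_le _ _).trans ?_
    push_cast [List.length_cons]
    linarith

/-- The terms in `f` vanish at fixed points, and the image of `γ` has the same endpoints, so the
potential `K` gives it the same integral. -/
theorem deviation_pow_of_fixed {X : Type u} [TopologicalSpace X] (c : SingularCochain 1 X)
    (f : X → ℝ) {g : X ≃ₜ X} {K : X → ℝ} (hK : IsPotential K (pullback 1 (g : C(X, X)) c - c))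
    {x y : X} (hx : g x = x) (hy : g y = y) (γ : Path x y) (n : ℕ) :
    deviation c f (g ^ n) γ = n * pathIntegral γ (pullback 1 (g : C(X, X)) c - c) := by
  have hfix {z : X} (hz : g z = z) (n : ℕ) : (g ^ n) z = z := by
    induction n with
    | zero => rfl
    | succ n ih =>
      rw [pow_succ]
      exact (congrArg _ hz).trans ih
  induction n with
  | zero => simp [deviation_one]
  | succ n ih =>
    rw [pow_succ', deviation_mul, ih, deviation, hK, hK, hfix hx, hfix hy, hx, hy]
    push_cast
    ring

/-! ### Word norms -/

section WordNorm

variable {Γ : Type*} [Group Γ] {S : Set Γ}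

theorem exists_word (hS : Subgroup.closure S = ⊤) (g : Γ) :
    ∃ l : List Γ, l.length = wordNorm S g ∧ (∀ s ∈ l, s ∈ S ∨ s⁻¹ ∈ S) ∧ l.prod = g := by
  -- Generation makes the set of lengths nonempty, excluding the default `sInf ∅ = 0`.
  refine Nat.sInf_mem (s := {k | ∃ l : List Γ, l.length = k ∧ (∀ s ∈ l, s ∈ S ∨ s⁻¹ ∈ S) ∧
    l.prod = g}) ?_
  have hg : g ∈ Submonoid.closure (S ∪ S⁻¹) := by
    rw [← Subgroup.closure_toSubmonoid, hS]
    trivial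
  obtain ⟨l, hl, h⟩ := Submonoid.exists_list_of_mem_closure hg
  exact ⟨l.length, l, rfl, hl, h⟩

theorem wordNorm_mul_le (hS : Subgroup.closure S = ⊤) (g h : Γ) :
    wordNorm S (g * h) ≤ wordNorm S g + wordNorm S h := by
  obtain ⟨l, hl, hlS, rfl⟩ := exists_word hS g
  obtain ⟨m, hm, hmS, rfl⟩ := exists_word hS h
  rw [← hl, ← hm]
  refine Nat.sInf_le ⟨l ++ m, by simp, fun s hs => ?_, by simp⟩
  rcases List.mem_append.1 hs with h | h
  exacts [hlS s h, hmS s h]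

/-- An element whose powers have word norms growing at least linearly has a positive translation
length. -/
theorem exists_hasTranslationLength_of_le (hS : Subgroup.closure S = ⊤) (g : Γ) {ε : ℝ}
    (hε : 0 < ε) (h : ∀ n : ℕ, n * ε ≤ wordNorm S (g ^ n)) :
    ∃ τ : ℝ, 0 < τ ∧ HasTranslationLength S g τ := by
  have hsub : Subadditive fun n => (wordNorm S (g ^ n) : ℝ) := fun m n => by
    dsimp only
    rw [pow_add]
    exact_mod_cast wordNorm_mul_le hS _ _
  have hbdd : BddBelow (Set.range fun n : ℕ => (wordNorm S (g ^ n) : ℝ) / n) :=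
    ⟨0, by rintro _ ⟨n, rfl⟩; positivity⟩
  have hlim := hsub.tendsto_lim hbdd
  refine ⟨hsub.lim, hε.trans_le (ge_of_tendsto hlim ?_), hlim⟩
  filter_upwards [eventually_gt_atTop 0] with n hn
  rw [le_div_iff₀ (by exact_mod_cast hn)]
  linarith [h n]

end WordNorm

end HomeoDistortion

end

theorem mainTheorem3 {X : Type u} [TopologicalSpace X] [CompactSpace X] [T2Space X]
    [PathConnectedSpace X] (hX : HomeoDistortion.HasUniversalCover X)
    (a : HomeoDistortion.H1 X) (α : HomeoDistortion.Z1 X) (hα : HomeoDistortion.H1.mk α = a)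
    (G : Subgroup (X ≃ₜ X)) (hG : G ≤ HomeoDistortion.homeoPreserving a)
    (g : G) (x y : X) (hx : (g : X ≃ₜ X) x = x) (hy : (g : X ≃ₜ X) y = y) (γ : Path x y)
    (hγ : HomeoDistortion.pathIntegral γ
      (HomeoDistortion.pullback 1 ((g : X ≃ₜ X) : C(X, X)) (α : HomeoDistortion.SingularCochain 1 X)
        - (α : HomeoDistortion.SingularCochain 1 X)) ≠ 0) :
    HomeoDistortion.IsUndistorted g := by
  subst hα
  obtain ⟨f, hf⟩ := HomeoDistortion.exists_forall_bound_deviation hX α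
  obtain ⟨K, hK⟩ := HomeoDistortion.exists_isPotential_of_mem_homeoPreserving α (hG g.2)
  intro Γ _ hg S hSfin hS
  choose C hC using fun s : Γ => hf (s : G) (hG s.1.2)
  -- Words also use inverses, hence `S⁻¹`. `M` may fail to be positive, for example if `S` is empty,
  -- hence `max M 1`.
  obtain ⟨M, hM⟩ := ((hSfin.union hSfin.inv).image C).bddAbove
  have hM0 : (0 : ℝ) < max M 1 := lt_max_of_lt_right one_pos
  refine HomeoDistortion.exists_hasTranslationLength_of_le hS _ (div_pos (abs_pos.2 hγ) hM0)
    fun n => ?_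
  obtain ⟨l, hl, hlS, hprod⟩ := HomeoDistortion.exists_word hS ((⟨g, hg⟩ : Γ) ^ n)
  have hle := HomeoDistortion.abs_deviation_list_prod_le (α : HomeoDistortion.SingularCochain 1 X) f
    (C := max M 1) (l.map (G.subtype.comp Γ.subtype)) (fun h hh x y γ => by
      obtain ⟨s, hs, rfl⟩ := List.mem_map.1 hh
      exact (hC s γ).trans ((hM ⟨s, hlS s hs, rfl⟩).trans (le_max_left _ _))) γ
  rw [← map_list_prod, hprod, map_pow, List.length_map, hl] at hle
  have hpow := HomeoDistortion.deviation_pow_of_fixed _ f hK hx hy γ n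
  change |HomeoDistortion.deviation _ f ((g : X ≃ₜ X) ^ n) γ| ≤ _ at hle
  rw [hpow, abs_mul, Nat.abs_cast] at hle
  rwa [← mul_div_assoc, div_le_iff₀ hM0]
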